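/- Let $K$ be a field and let $E$ and $F$ be finite directed graphs (finitely many vertices and finitely many edges; loops and multiple edges are allowed), with source and range maps $s,r$. The Leavitt path algebra $L_K(E)$ is the $K$-algebra generated by the vertices $v\in E^0$, the edges $e\in E^1$ and the ghost edges $e^*$ $(e\in E^1)$ subject to the relations $vw=\delta_{v,w}v$; $s(e)e=er(e)=e$; $r(e)e^*=e^*s(e)=e^*$; $e^*f=\delta_{e,f}r(e)$ for all $v,w\in E^0$ and $e,f\in E^1$; and $v=\sum_{s(e)=v}ee^*$ for every vertex $v$ that is not a sink. A cycle is a closed path $c=e_1\cdots e_n$ of length $n\ge 1$ whose vertices $s(e_1),\dots,s(e_n)$ are pairwise distinct; it has an exit if there are an index $i$ and an edge $e\ne e_i$ with $s(e)=s(e_i)$. A cycle $c$ is extreme if it has an exit and every path starting at a vertex of $c$ can be prolonged to a path ending at a vertex of $c$. Let $P_{ec}^E\subseteq E^0$ be the set of vertices lying on extreme cycles, and let $I(P_{ec}^E)$ be the two-sided ideal of $L_K(E)$ generated by $P_{ec}^E$; likewise for $F$. Then for every ring isomorphism $\varphi\colon L_K(E)\to L_K(F)$ (not necessarily $K$-linear),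 $$\varphi\bigl(I(P_{ec}^E)\bigr)=I(P_{ec}^F).$$ -/

import Mathlib

/-! A directed graph is a quiver: `V` is its set of vertices, `Quiver.Total V` its set of edges,
and an edge `e` has source `e.left` and range `e.right`. Paths are `Quiver.Path`s. -/

namespace LeavittPath

section Graph

variable {V : Type*} [Quiver V]

/-- The list of the consecutive edges of a path. -/
def edgeList {a : V} : ∀ {b : V}, Quiver.Path a b → List (Quiver.Total V)
  | _, .nil => []
  | _, .cons p e => edgeList p ++ [⟨_, _, e⟩]

/-- A closed path is a cycle if it has positive length and the sources of its edges are
pairwise different. -/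
def IsCycle {v : V} (c : Quiver.Path v v) : Prop :=
  0 < c.length ∧ ((edgeList c).map Quiver.Total.left).Nodup

/-- A path has an exit if some edge starts at the source of one of its edges `f`
and differs from `f`. -/
def HasExit {a b : V} (p : Quiver.Path a b) : Prop :=
  ∃ f ∈ edgeList p, ∃ e : Quiver.Total V, e.left = f.left ∧ e ≠ f

/-- An extreme cycle: a cycle with exits such that each path `_l` that starts at a vertex of the
cycle can be prolonged to a path that ends at a vertex of the cycle. -/
def IsExtremeCycle {v : V} (c : Quiver.Path v v) : Prop :=
  IsCycle c ∧ HasExit c ∧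
    ∀ u ∈ c.vertices, ∀ (w : V) (_l : Quiver.Path u w),
      ∃ x ∈ c.vertices, Nonempty (Quiver.Path w x)

variable (V) in
/-- The set of the vertices that lie on extreme cycles. -/
def extremeCycleVertices : Set V :=
  {u | ∃ (v : V) (c : Quiver.Path v v), IsExtremeCycle c ∧ u ∈ c.vertices}

end Graph

section Algebra

/-- The generators of the Leavitt path algebra: vertices, edges and ghost edges. -/
inductive Generator (V : Type*) [Quiver V]
  | vertex (v : V)
  | edge (e : Quiver.Total V)
  | ghost (e : Quiver.Total V)

variable (K : Type*) [Field K] (V : Type*) [Quiver V]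

/-- A generator as an element of the free unital `K`-algebra. -/
abbrev gen (x : Generator V) : FreeAlgebra K (Generator V) := FreeAlgebra.ι K x

open Classical in
/-- The defining relations of the Leavitt path algebra of a finite graph. The relation `one`
says that the identity is the sum of the vertices. For finitely many vertices, the relations
(V), (E1), (E2) imply that this sum is the identity of the (not a priori unital) algebra which
they present, so that `one` is needed only since `FreeAlgebra` adjoins a further identity. -/
inductive Rel [Fintype V] [Fintype (Quiver.Total V)] :
    FreeAlgebra K (Generator V) → FreeAlgebra K (Generator V) → Prop
  | one : Rel 1 (∑ v : V, gen K V (.vertex v))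
  | vertex_mul_self (v : V) :
      Rel (gen K V (.vertex v) * gen K V (.vertex v)) (gen K V (.vertex v))
  | vertex_mul_of_ne (v w : V) (h : v ≠ w) :
      Rel (gen K V (.vertex v) * gen K V (.vertex w)) 0
  | source_mul_edge (e : Quiver.Total V) :
      Rel (gen K V (.vertex e.left) * gen K V (.edge e)) (gen K V (.edge e))
  | edge_mul_range (e : Quiver.Total V) :
      Rel (gen K V (.edge e) * gen K V (.vertex e.right)) (gen K V (.edge e))
  | range_mul_ghost (e : Quiver.Total V) :
      Rel (gen K V (.vertex e.right) * gen K V (.ghost e)) (gen K V (.ghost e))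
  | ghost_mul_source (e : Quiver.Total V) :
      Rel (gen K V (.ghost e) * gen K V (.vertex e.left)) (gen K V (.ghost e))
  | ghost_mul_edge_self (e : Quiver.Total V) :
      Rel (gen K V (.ghost e) * gen K V (.edge e)) (gen K V (.vertex e.right))
  | ghost_mul_edge_of_ne (e f : Quiver.Total V) (h : e ≠ f) :
      Rel (gen K V (.ghost e) * gen K V (.edge f)) 0
  | sum_edge_mul_ghost (v : V) (h : ∃ e : Quiver.Total V, e.left = v) :
      Rel (gen K V (.vertex v))
        (∑ e : Quiver.Total V with e.left = v, gen K V (.edge e) * gen K V (.ghost e))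

variable [Fintype V] [Fintype (Quiver.Total V)]

/-- The Leavitt path algebra of a finite graph with coefficients in the field `K`. -/
abbrev LeavittPathAlgebra : Type _ := RingQuot (Rel K V)

/-- A vertex as an element of the Leavitt path algebra. -/
noncomputable def vertexElem (v : V) : LeavittPathAlgebra K V :=
  RingQuot.mkAlgHom K (Rel K V) (gen K V (.vertex v))

/-- The two-sided ideal generated by a set of vertices. -/
def vertexIdeal (X : Set V) : TwoSidedIdeal (LeavittPathAlgebra K V) :=
  TwoSidedIdeal.span (vertexElem K V '' X)

end Algebra

end LeavittPath

/-!
The ideal `I(P_ec)` is shown to be the two-sided ideal spanned by all elements with a property that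
is formulated in terms of the ring only (`IsExtremeElement`), and hence is preserved by all ring
isomorphisms. An element `a` has this property if each nonzero `b` in the ideal `⟨a⟩` satisfies
`a ∈ ⟨b⟩`, and satisfies `bpbqb ≠ bqbpb` for some `p` and `q`.

Call a vertex terminal if every path which starts at it can be prolonged to a path that returns to
it, and branching if two different edges start at some vertex reachable from it. The vertices on
extreme cycles are the terminal branching vertices (`mem_extremeCycleVertices_iff`).

The main tool is the reduction of an arbitrary nonzero element
(`exists_terminal_sub_mem_closedPathSpan`): on multiplying `a ≠ 0` on the right by suitable edges,
its ghost paths disappear, and on multiplying the resulting combination of paths on the left by the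
ghost of a shortest one, it acquires a nonzero constant term. The result `x a y` is `k u` plus a
combination of closed paths of positive length at a vertex `u`, with a scalar `k ≠ 0`. Conjugation
by a path preserves this form, so that `u` may be taken to be terminal. Such an element is not zero
(`ne_zero_of_sub_mem_closedPathSpan`), since `L_K(E)` acts on a graded vector space on which
vertices act as nonzero projections of degree zero, and edges raise degrees by one.

If the terminal vertex `u` is not branching, it is a sink or lies on a cycle without exits. In this
case the corner `uLu` is commutative (`commute_corner`), so each nonzero `b` in it satisfies
`bpbqb = bqbpb` for all `p` and `q`. If `u` is branching, then two closed paths `p` and `q` with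
different first edges pass through a vertex reachable from `u`, and conjugation by `pⁿ q` for a
suitable `n` kills all terms but the constant one. Thus `x a y = u` for some `x` and `y`
(`exists_mul_mul_eq_vertexElem`). The corner at the base of these closed paths contains a proper
isometry, and hence is not commutative.

It follows that the vertices on extreme cycles are extreme elements
(`isExtremeElement_vertexElem`): a nonzero element of `⟨u⟩` can only be reduced to vertices in the
component of `u`. Conversely, a nonzero extreme element cannot be reduced to a commutative corner,
so its ideal contains a vertex `u` on an extreme cycle, and by minimality it lies in `⟨u⟩`
(`IsExtremeElement.mem_vertexIdeal`).
-/

namespace LeavittPath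

/-! ### Walks as lists of edges -/

section Walk

variable {V : Type*} [Quiver V]

/-- `Walk v l w` says that the edges of the list `l` are the consecutive edges of a path from `v`
to `w`. Paths are encoded by their lists of edges since these can be compared even if their
endpoints are not definitionally equal. -/
def Walk : V → List (Quiver.Total V) → V → Prop
  | v, [], w => v = w
  | v, e :: l, w => e.left = v ∧ Walk e.right l w

/-- `Reach v w` says that there is a path from `v` to `w`. -/
def Reach (v w : V) : Prop := ∃ l, Walk v l w

@[simp] lemma walk_nil {v w : V} : Walk v [] w ↔ v = w := Iff.rfl

@[simp] lemma walk_cons {v w : V} {e : Quiver.Total V} {l : List (Quiver.Total V)} :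
    Walk v (e :: l) w ↔ e.left = v ∧ Walk e.right l w := Iff.rfl

lemma walk_append {v w : V} {l m : List (Quiver.Total V)} :
    Walk v (l ++ m) w ↔ ∃ t, Walk v l t ∧ Walk t m w := by
  induction l generalizing v with
  | nil => simp
  | cons e l ih => simp [ih, and_assoc]

lemma Walk.append {v t w : V} {l m : List (Quiver.Total V)} (h : Walk v l t) (h' : Walk t m w) :
    Walk v (l ++ m) w := walk_append.2 ⟨t, h, h'⟩

lemma Walk.exists_reach_of_mem {v w : V} {l : List (Quiver.Total V)} (h : Walk v l w)
    {e : Quiver.Total V} (he : e ∈ l) : Reach v e.left ∧ Reach e.right w := by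
  obtain ⟨l₁, l₂, rfl⟩ := List.append_of_mem he
  obtain ⟨t, h1, h2⟩ := walk_append.1 h
  exact ⟨⟨l₁, h2.1 ▸ h1⟩, ⟨l₂, h2.2⟩⟩

lemma Reach.refl (v : V) : Reach v v := ⟨[], rfl⟩

lemma Reach.trans {v t w : V} (h : Reach v t) (h' : Reach t w) : Reach v w := by
  obtain ⟨l, hl⟩ := h
  obtain ⟨m, hm⟩ := h'
  exact ⟨l ++ m, hl.append hm⟩

lemma reach_edge (e : Quiver.Total V) : Reach e.left e.right := ⟨[e], rfl, rfl⟩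

lemma walk_edgeList {v w : V} (p : Quiver.Path v w) : Walk v (edgeList p) w := by
  induction p with
  | nil => rfl
  | cons p e ih => exact ih.append ⟨rfl, rfl⟩

lemma edgeList_comp {u v w : V} (p : Quiver.Path u v) (q : Quiver.Path v w) :
    edgeList (p.comp q) = edgeList p ++ edgeList q := by
  induction q with
  | nil => simp [edgeList]
  | cons q e ih => simp [edgeList, ih]

lemma length_edgeList {v w : V} (p : Quiver.Path v w) : (edgeList p).length = p.length := by
  induction p with
  | nil => rfl
  | cons p e ih => simp [edgeList, ih]

lemma Walk.exists_path {v w : V} {l : List (Quiver.Total V)} (h : Walk v l w) :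
    ∃ p : Quiver.Path v w, edgeList p = l := by
  induction l generalizing v with
  | nil => obtain rfl := h; exact ⟨.nil, rfl⟩
  | cons e l ih =>
    obtain ⟨rfl, h⟩ := h
    obtain ⟨p, rfl⟩ := ih h
    refine ⟨(Quiver.Hom.toPath e.hom).comp p, ?_⟩
    rw [edgeList_comp]
    rfl

lemma nonempty_path_iff_reach {v w : V} : Nonempty (Quiver.Path v w) ↔ Reach v w :=
  ⟨fun ⟨p⟩ => ⟨_, walk_edgeList p⟩, fun ⟨_, h⟩ => ⟨h.exists_path.choose⟩⟩

lemma reach_of_mem_vertices {v w x : V} (p : Quiver.Path v w) (hx : x ∈ p.vertices) :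
    Reach v x ∧ Reach x w := by
  induction p with
  | nil =>
    obtain rfl : x = v := by simpa using hx
    exact ⟨.refl _, .refl _⟩
  | cons p e ih =>
    rcases (Quiver.Path.mem_vertices_cons p e).1 hx with h | rfl
    · exact ⟨(ih h).1, (ih h).2.trans (reach_edge ⟨_, _, e⟩)⟩
    · exact ⟨⟨_, walk_edgeList (p.cons e)⟩, .refl _⟩

/-! ### Terminal vertices -/

/-- A vertex is terminal if each path that starts at it can be prolonged to a path that returns
to it, that is, if its strongly connected component has no edges to other components. -/
def IsTerminal (u : V) : Prop := ∀ w, Reach u w → Reach w u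

/-- A vertex is branching if two different edges start at some vertex reachable from it. -/
def IsBranching (u : V) : Prop :=
  ∃ e f : Quiver.Total V, e ≠ f ∧ e.left = f.left ∧ Reach u e.left

lemma IsTerminal.of_reach {u w : V} (h : IsTerminal u) (hw : Reach u w) : IsTerminal w :=
  fun x hx => (h x (hw.trans hx)).trans hw

lemma IsBranching.of_reach {u w : V} (h : IsBranching u) (hw : Reach w u) : IsBranching w := by
  obtain ⟨e, f, h1, h2, h3⟩ := h
  exact ⟨e, f, h1, h2, hw.trans h3⟩

lemma exists_terminal [Finite V] (v : V) : ∃ u, Reach v u ∧ IsTerminal u := by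
  let _ : Preorder V :=
    { le := Reach, le_refl := Reach.refl, le_trans := fun _ _ _ => Reach.trans }
  obtain ⟨u, hu, hmax⟩ := Set.finite_univ.exists_le_maximal (Set.mem_univ v)
  exact ⟨u, hu, fun w hw => hmax.2 (Set.mem_univ w) hw⟩

lemma isTerminal_isBranching_of_mem {u : V} (hu : u ∈ extremeCycleVertices V) :
    IsTerminal u ∧ IsBranching u := by
  obtain ⟨v, c, ⟨-, ⟨f, hf, e, hef, hne⟩, hc⟩, huc⟩ := hu
  have hu := reach_of_mem_vertices c huc
  refine ⟨fun w ⟨l, hl⟩ => ?_, e, f, hne, hef, ?_⟩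
  · obtain ⟨x, hx, hwx⟩ := hc u huc w hl.exists_path.choose
    exact ((nonempty_path_iff_reach.1 hwx).trans (reach_of_mem_vertices c hx).2).trans hu.1
  · rw [hef]
    exact hu.2.trans ((walk_edgeList c).exists_reach_of_mem hf).1

/-- A closed walk of minimal positive length passes through each of its vertices only once. -/
lemma exists_nodup_walk {u : V} {l : List (Quiver.Total V)} (hl : Walk u l u) (h0 : l ≠ []) :
    ∃ m, Walk u m u ∧ m ≠ [] ∧ (m.map Quiver.Total.left).Nodup := by
  by_cases hn : (l.map Quiver.Total.left).Nodup
  · exact ⟨l, hl, h0, hn⟩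
  · -- a repeated source allows to cut out the part of the walk between its occurrences
    obtain ⟨i, j, hij, hj, he⟩ : ∃ i j : ℕ, i < j ∧ ∃ hj : j < l.length,
        ∃ hi : i < l.length, l[i].left = l[j].left := by
      simp only [List.Nodup, List.pairwise_iff_getElem, List.length_map, List.getElem_map] at hn
      push Not at hn
      obtain ⟨i, j, hi, hj, hij, h⟩ := hn
      exact ⟨i, j, hij, hj, hi, h⟩
    obtain ⟨hi, he⟩ := he
    have hw : Walk u (l.take i ++ l.drop j) u := by
      have h1 : Walk u (l.take i ++ l[i] :: l.drop (i + 1)) u := by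
        rwa [List.getElem_cons_drop, List.take_append_drop]
      have h2 : Walk u (l.take j ++ l[j] :: l.drop (j + 1)) u := by
        rwa [List.getElem_cons_drop, List.take_append_drop]
      obtain ⟨t, h3, h4, -⟩ := walk_append.1 h1
      obtain ⟨t', -, h5, h6⟩ := walk_append.1 h2
      rw [← List.getElem_cons_drop hj]
      exact h3.append ⟨he ▸ h4, h6⟩
    have hlt : (l.take i ++ l.drop j).length < l.length := by
      simp only [List.length_append, List.length_take, List.length_drop]
      omega
    exact exists_nodup_walk hw (List.ne_nil_of_length_pos (by
      simp only [List.length_append, List.length_drop]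
      omega))
termination_by l.length

lemma Walk.next_mem {v w : V} {l : List (Quiver.Total V)} (h : Walk v l w)
    {f : Quiver.Total V} (hf : f ∈ l) : f.right = w ∨ ∃ g ∈ l, g.left = f.right := by
  obtain ⟨l₁, l₂, rfl⟩ := List.append_of_mem hf
  obtain ⟨t, -, -, h2⟩ := walk_append.1 h
  cases l₂ with
  | nil => exact .inl h2
  | cons g l₂ => exact .inr ⟨g, by simp, h2.1⟩

lemma mem_extremeCycleVertices_iff {u : V} :
    u ∈ extremeCycleVertices V ↔ IsTerminal u ∧ IsBranching u := by
  refine ⟨isTerminal_isBranching_of_mem, fun ⟨ht, e, f, hne, hef, hr⟩ => ?_⟩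
  obtain ⟨l₁, hl₁⟩ := hr
  obtain ⟨l₂, hl₂⟩ := ht e.right (.trans ⟨l₁, hl₁⟩ (reach_edge e))
  obtain ⟨m, hm, hm0, hnd⟩ := exists_nodup_walk
    (hl₁.append (show Walk e.left (e :: l₂) u from ⟨rfl, hl₂⟩)) (by simp)
  obtain ⟨c, rfl⟩ := hm.exists_path
  refine ⟨u, c, ⟨⟨?_, hnd⟩, ?_, ?_⟩, c.start_mem_vertices⟩
  · rw [← length_edgeList]
    exact List.length_pos_of_ne_nil hm0
  · -- without exits, the walks starting at `u` never leave the cycle and never branch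
    by_contra hex
    have key : ∀ g ∈ edgeList c, ∀ g' : Quiver.Total V, g'.left = g.left → g' = g := by
      intro g hg g' h
      by_contra hgg
      exact hex ⟨g, hg, g', h, hgg⟩
    obtain ⟨g₀, hg₀, hg₀u⟩ : ∃ g ∈ edgeList c, g.left = u := by
      cases hc : edgeList c with
      | nil => exact absurd hc hm0
      | cons g l =>
        rw [hc] at hm
        exact ⟨g, by simp, hm.1⟩
    have hstay : ∀ (l : List (Quiver.Total V)) (v w : V), Walk v l w →
        (∃ g ∈ edgeList c, g.left = v) → ∃ g ∈ edgeList c, g.left = w := by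
      intro l
      induction l with
      | nil => rintro v w rfl h; exact h
      | cons a l ih =>
        rintro v w ⟨rfl, hw⟩ ⟨g, hg, hgv⟩
        obtain rfl := key g hg a hgv.symm
        rcases hm.next_mem hg with h | h
        · exact ih _ _ hw ⟨g₀, hg₀, hg₀u.trans h.symm⟩
        · exact ih _ _ hw h
    obtain ⟨g, hg, hgl⟩ := hstay l₁ u e.left hl₁ ⟨g₀, hg₀, hg₀u⟩
    exact hne ((key g hg e hgl.symm).trans (key g hg f (hef ▸ hgl.symm)).symm)
  · intro x hx w p
    refine ⟨u, c.start_mem_vertices, nonempty_path_iff_reach.2 (ht w ?_)⟩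
    exact (reach_of_mem_vertices c hx).1.trans (nonempty_path_iff_reach.1 ⟨p⟩)

/-- Below a vertex that is not branching, walks are determined by their source and length. -/
lemma Walk.eq_of_length_eq {u t t' : V} (hu : ¬ IsBranching u) {l m : List (Quiver.Total V)}
    (hl : Walk u l t) (hm : Walk u m t') (h : l.length = m.length) : l = m := by
  induction l generalizing u m with
  | nil => exact (List.length_eq_zero_iff.1 h.symm).symm
  | cons e l ih =>
    cases m with
    | nil => simp at h
    | cons f m =>
      obtain ⟨rfl, hl⟩ := hl
      obtain ⟨hf, hm⟩ := hm
      obtain rfl : e = f := by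
        by_contra hne
        exact hu ⟨e, f, hne, hf.symm, .refl _⟩
      rw [ih (fun hb => hu (hb.of_reach (reach_edge e))) hl hm (by simpa using h)]

/-- Below a terminal branching vertex, the two edges of a branching can be prolonged to closed
walks. -/
lemma exists_two_loops {u : V} (ht : IsTerminal u) (hb : IsBranching u) :
    ∃ (t : V) (e f : Quiver.Total V) (l m : List (Quiver.Total V)), Reach u t ∧ e ≠ f ∧
      Walk t (e :: l) t ∧ Walk t (f :: m) t := by
  obtain ⟨e, f, hne, hef, hr⟩ := hb
  obtain ⟨l, hl⟩ := ht.of_reach hr _ (reach_edge e)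
  obtain ⟨m, hm⟩ := ht.of_reach hr _ (hef ▸ reach_edge f)
  exact ⟨e.left, e, f, l, m, hr, hne, ⟨rfl, hl⟩, ⟨hef.symm, hm⟩⟩

end Walk

/-! ### Comparing words -/

section Words

variable {α : Type*}

/-- The word `pⁿ q`. -/
def powWord (p q : List α) (n : ℕ) : List α := (List.replicate n p).flatten ++ q

lemma powWord_succ (p q : List α) (n : ℕ) : powWord p q (n + 1) = p ++ powWord p q n := by
  simp [powWord, List.replicate_succ]

lemma Walk.powWord {V : Type*} [Quiver V] {t : V} {p q : List (Quiver.Total V)}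
    (hp : Walk t p t) (hq : Walk t q t) (n : ℕ) : Walk t (powWord p q n) t := by
  induction n with
  | zero => simpa [LeavittPath.powWord] using hq
  | succ n ih => rw [powWord_succ]; exact hp.append ih

/-- If `p` and `q` start with different letters, no word `pᵐ q` is an initial segment of another
one. -/
lemma powWord_prefix {a b : α} (hab : a ≠ b) {l m : List α} {i j : ℕ}
    (h : powWord (a :: l) (b :: m) i <+: powWord (a :: l) (b :: m) j) : i = j := by
  induction i generalizing j with
  | zero =>
    cases j with
    | zero => rfl
    | succ j =>
      rw [powWord_succ] at h
      simp [powWord, hab.symm] at h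
  | succ i ih =>
    cases j with
    | zero =>
      rw [powWord_succ] at h
      simp [powWord, hab] at h
    | succ j =>
      rw [powWord_succ, powWord_succ, List.prefix_append_right_inj] at h
      rw [ih h]

lemma prefix_flatten_replicate_append {d x : List α} (h : d <+: x ++ d) (k : ℕ) :
    d <+: (List.replicate k x).flatten ++ d := by
  induction k with
  | zero => simp
  | succ k ih =>
    rw [List.replicate_succ, List.flatten_cons, List.append_assoc]
    exact h.trans ((List.prefix_append_right_inj x).2 ih)

/-- If `d` is an initial segment of `x d`, it is one of a power of `x`. Among words `d` which are
not comparable, this happens for at most one. -/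
lemma prefix_or_prefix_of_prefix_append {d d' x : List α} (hx : x ≠ []) (h : d <+: x ++ d)
    (h' : d' <+: x ++ d') : d <+: d' ∨ d' <+: d := by
  have key : ∀ {d : List α} (k : ℕ), d <+: x ++ d → d.length ≤ k →
      d <+: (List.replicate k x).flatten := by
    intro d k hd hk
    refine List.prefix_of_prefix_length_le (prefix_flatten_replicate_append hd k)
      (List.prefix_append _ _) (hk.trans ?_)
    rw [List.length_flatten, List.map_replicate, List.sum_replicate, smul_eq_mul]
    exact Nat.le_mul_of_pos_right k (List.length_pos_of_ne_nil hx)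
  exact List.prefix_or_prefix_of_prefix (key (max d.length d'.length) h (le_max_left _ _))
    (key _ h' (le_max_right _ _))

end Words

section Relations

open scoped Classical

variable (K : Type*) [Field K] {V : Type*} [Quiver V] [Fintype V] [Fintype (Quiver.Total V)]

/-! ### Monomials in the Leavitt path algebra -/

/-- An edge as an element of the Leavitt path algebra. -/
noncomputable def edgeElem (e : Quiver.Total V) : LeavittPathAlgebra K V :=
  RingQuot.mkAlgHom K (Rel K V) (gen K V (.edge e))

/-- A ghost edge as an element of the Leavitt path algebra. -/
noncomputable def ghostElem (e : Quiver.Total V) : LeavittPathAlgebra K V :=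
  RingQuot.mkAlgHom K (Rel K V) (gen K V (.ghost e))

lemma sum_vertexElem : ∑ v : V, vertexElem K V v = 1 := by
  simpa [vertexElem] using (RingQuot.mkAlgHom_rel K (Rel.one (K := K) (V := V))).symm

lemma vertexElem_mul_self (v : V) : vertexElem K V v * vertexElem K V v = vertexElem K V v := by
  simpa [vertexElem] using RingQuot.mkAlgHom_rel K (Rel.vertex_mul_self (K := K) v)

lemma vertexElem_mul_of_ne {v w : V} (h : v ≠ w) : vertexElem K V v * vertexElem K V w = 0 := by
  simpa [vertexElem] using RingQuot.mkAlgHom_rel K (Rel.vertex_mul_of_ne (K := K) v w h)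

lemma vertexElem_mul_edgeElem_self (e : Quiver.Total V) :
    vertexElem K V e.left * edgeElem K e = edgeElem K e := by
  simpa [vertexElem, edgeElem] using RingQuot.mkAlgHom_rel K (Rel.source_mul_edge (K := K) e)

lemma edgeElem_mul_vertexElem_self (e : Quiver.Total V) :
    edgeElem K e * vertexElem K V e.right = edgeElem K e := by
  simpa [vertexElem, edgeElem] using RingQuot.mkAlgHom_rel K (Rel.edge_mul_range (K := K) e)

lemma vertexElem_mul_ghostElem_self (e : Quiver.Total V) :
    vertexElem K V e.right * ghostElem K e = ghostElem K e := by
  simpa [vertexElem, ghostElem] using RingQuot.mkAlgHom_rel K (Rel.range_mul_ghost (K := K) e)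

lemma ghostElem_mul_vertexElem_self (e : Quiver.Total V) :
    ghostElem K e * vertexElem K V e.left = ghostElem K e := by
  simpa [vertexElem, ghostElem] using RingQuot.mkAlgHom_rel K (Rel.ghost_mul_source (K := K) e)

lemma ghostElem_mul_edgeElem_self (e : Quiver.Total V) :
    ghostElem K e * edgeElem K e = vertexElem K V e.right := by
  simpa [vertexElem, edgeElem, ghostElem] using
    RingQuot.mkAlgHom_rel K (Rel.ghost_mul_edge_self (K := K) e)

lemma ghostElem_mul_edgeElem_of_ne {e f : Quiver.Total V} (h : e ≠ f) :
    ghostElem K e * edgeElem K f = 0 := by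
  simpa [edgeElem, ghostElem] using
    RingQuot.mkAlgHom_rel K (Rel.ghost_mul_edge_of_ne (K := K) e f h)

lemma sum_edgeElem_mul_ghostElem {v : V} (h : ∃ e : Quiver.Total V, e.left = v) :
    ∑ e : Quiver.Total V with e.left = v, edgeElem K e * ghostElem K e = vertexElem K V v := by
  simpa [vertexElem, edgeElem, ghostElem] using
    (RingQuot.mkAlgHom_rel K (Rel.sum_edge_mul_ghost (K := K) v h)).symm

lemma vertexElem_mul_edgeElem_of_ne {v : V} {e : Quiver.Total V} (h : v ≠ e.left) :
    vertexElem K V v * edgeElem K e = 0 := by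
  rw [← vertexElem_mul_edgeElem_self, ← mul_assoc, vertexElem_mul_of_ne K h, zero_mul]

lemma edgeElem_mul_vertexElem_of_ne {v : V} {e : Quiver.Total V} (h : e.right ≠ v) :
    edgeElem K e * vertexElem K V v = 0 := by
  rw [← edgeElem_mul_vertexElem_self, mul_assoc, vertexElem_mul_of_ne K h, mul_zero]

lemma ghostElem_mul_vertexElem_of_ne {v : V} {e : Quiver.Total V} (h : e.left ≠ v) :
    ghostElem K e * vertexElem K V v = 0 := by
  rw [← ghostElem_mul_vertexElem_self, mul_assoc, vertexElem_mul_of_ne K h, mul_zero]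

/-- The element `e₁ ⋯ eₙ t` for a list of edges `[e₁, …, eₙ]` and a vertex `t`. It is only used
for walks that end at `t`; the factor `t` is needed for the empty list. -/
noncomputable def pathElem : List (Quiver.Total V) → V → LeavittPathAlgebra K V
  | [], t => vertexElem K V t
  | e :: l, t => edgeElem K e * pathElem l t

/-- The element `t eₙ* ⋯ e₁*` for a list of edges `[e₁, …, eₙ]` and a vertex `t`. -/
noncomputable def ghostPathElem : List (Quiver.Total V) → V → LeavittPathAlgebra K V
  | [], t => vertexElem K V t
  | e :: l, t => ghostPathElem l t * ghostElem K e

variable {K}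

lemma Walk.vertexElem_mul_pathElem {v t : V} {l : List (Quiver.Total V)} (h : Walk v l t) :
    vertexElem K V v * pathElem K l t = pathElem K l t := by
  cases l with
  | nil => obtain rfl := h; exact vertexElem_mul_self K v
  | cons e l => rw [← h.1, pathElem, ← mul_assoc, vertexElem_mul_edgeElem_self]

lemma Walk.vertexElem_mul_pathElem_of_ne {v w t : V} {l : List (Quiver.Total V)}
    (h : Walk v l t) (hw : w ≠ v) : vertexElem K V w * pathElem K l t = 0 := by
  rw [← h.vertexElem_mul_pathElem, ← mul_assoc, vertexElem_mul_of_ne K hw, zero_mul]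

lemma pathElem_mul_vertexElem (l : List (Quiver.Total V)) (t : V) :
    pathElem K l t * vertexElem K V t = pathElem K l t := by
  induction l with
  | nil => exact vertexElem_mul_self K t
  | cons e l ih => rw [pathElem, mul_assoc, ih]

lemma pathElem_mul_vertexElem_of_ne (l : List (Quiver.Total V)) {t w : V} (h : t ≠ w) :
    pathElem K l t * vertexElem K V w = 0 := by
  rw [← pathElem_mul_vertexElem, mul_assoc, vertexElem_mul_of_ne K h, mul_zero]

lemma vertexElem_mul_ghostPathElem (l : List (Quiver.Total V)) (t : V) :
    vertexElem K V t * ghostPathElem K l t = ghostPathElem K l t := by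
  induction l with
  | nil => exact vertexElem_mul_self K t
  | cons e l ih => rw [ghostPathElem, ← mul_assoc, ih]

lemma Walk.ghostPathElem_mul_vertexElem {v t : V} {l : List (Quiver.Total V)} (h : Walk v l t) :
    ghostPathElem K l t * vertexElem K V v = ghostPathElem K l t := by
  cases l with
  | nil => obtain rfl := h; exact vertexElem_mul_self K v
  | cons e l => rw [← h.1, ghostPathElem, mul_assoc, ghostElem_mul_vertexElem_self]

lemma Walk.ghostPathElem_mul_vertexElem_of_ne {v w t : V} {l : List (Quiver.Total V)}
    (h : Walk v l t) (hw : v ≠ w) : ghostPathElem K l t * vertexElem K V w = 0 := by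
  rw [← h.ghostPathElem_mul_vertexElem, mul_assoc, vertexElem_mul_of_ne K hw, mul_zero]

lemma pathElem_append (l : List (Quiver.Total V)) {m : List (Quiver.Total V)} {t t' : V}
    {v : V} (hl : Walk v l t) (hm : Walk t m t') :
    pathElem K (l ++ m) t' = pathElem K l t * pathElem K m t' := by
  induction l generalizing v with
  | nil => exact hm.vertexElem_mul_pathElem.symm
  | cons e l ih => rw [List.cons_append, pathElem, pathElem, ih hl.2, mul_assoc]

lemma ghostPathElem_append (l : List (Quiver.Total V)) {m : List (Quiver.Total V)} {t t' : V}
    {v : V} (hl : Walk v l t) (hm : Walk t m t') :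
    ghostPathElem K (l ++ m) t' = ghostPathElem K m t' * ghostPathElem K l t := by
  induction l generalizing v with
  | nil => exact hm.ghostPathElem_mul_vertexElem.symm
  | cons e l ih => rw [List.cons_append, ghostPathElem, ghostPathElem, ih hl.2, mul_assoc]

lemma Walk.ghostPathElem_mul_pathElem_self {v t : V} {l : List (Quiver.Total V)}
    (h : Walk v l t) : ghostPathElem K l t * pathElem K l t = vertexElem K V t := by
  induction l generalizing v with
  | nil => exact vertexElem_mul_self K t
  | cons e l ih =>
    rw [ghostPathElem, pathElem, mul_assoc, ← mul_assoc (ghostElem K e),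
      ghostElem_mul_edgeElem_self, h.2.vertexElem_mul_pathElem, ih h.2]

lemma ghostPathElem_mul_pathElem_cons_of_ne {e f : Quiver.Total V} (h : e ≠ f)
    (l m : List (Quiver.Total V)) (t t' : V) :
    ghostPathElem K (e :: l) t * pathElem K (f :: m) t' = 0 := by
  rw [ghostPathElem, pathElem, mul_assoc, ← mul_assoc (ghostElem K e),
    ghostElem_mul_edgeElem_of_ne K h, zero_mul, mul_zero]

/-- The product of a ghost path and a path that is not shorter vanishes unless the first one is an
initial segment of the second one. -/
lemma Walk.ghostPathElem_mul_pathElem {v v' t t' : V} {l m : List (Quiver.Total V)}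
    (hl : Walk v l t) (hm : Walk v' m t') (h : l.length ≤ m.length) :
    ghostPathElem K l t * pathElem K m t' = 0 ∨
      ∃ n, m = l ++ n ∧ Walk t n t' ∧ ghostPathElem K l t * pathElem K m t' = pathElem K n t' := by
  induction l generalizing v v' m with
  | nil =>
    by_cases ht : t = v'
    · subst ht
      exact .inr ⟨m, rfl, hm, hm.vertexElem_mul_pathElem⟩
    · exact .inl (hm.vertexElem_mul_pathElem_of_ne ht)
  | cons e l ih =>
    cases m with
    | nil => simp at h
    | cons f m =>
      by_cases hef : e = f
      · subst hef
        have hmul : ghostPathElem K (e :: l) t * pathElem K (e :: m) t' =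
            ghostPathElem K l t * pathElem K m t' := by
          rw [ghostPathElem, pathElem, mul_assoc, ← mul_assoc (ghostElem K e),
            ghostElem_mul_edgeElem_self, hm.2.vertexElem_mul_pathElem]
        rw [hmul]
        rcases ih hl.2 hm.2 (by simpa using h) with h0 | ⟨n, rfl, hn, h1⟩
        · exact .inl h0
        · exact .inr ⟨n, rfl, hn, h1⟩
      · exact .inl (ghostPathElem_mul_pathElem_cons_of_ne hef _ _ _ _)

variable (K V) in
/-- The span of the monomials `α β*` for paths `α` and `β` with the same range such that `β` has
length at most `N`. -/
noncomputable def monomialSpan (N : ℕ) : Submodule K (LeavittPathAlgebra K V) :=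
  Submodule.span K {x | ∃ (v v' t : V) (l m : List (Quiver.Total V)), Walk v l t ∧ Walk v' m t ∧
    m.length ≤ N ∧ x = pathElem K l t * ghostPathElem K m t}

lemma monomialSpan_mono {M N : ℕ} (h : M ≤ N) : monomialSpan K V M ≤ monomialSpan K V N :=
  Submodule.span_mono fun _ ⟨v, v', t, l, m, h1, h2, h3, h4⟩ =>
    ⟨v, v', t, l, m, h1, h2, h3.trans h, h4⟩

lemma mem_monomialSpan {v v' t : V} {l m : List (Quiver.Total V)} (hl : Walk v l t)
    (hm : Walk v' m t) {N : ℕ} (h : m.length ≤ N) :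
    pathElem K l t * ghostPathElem K m t ∈ monomialSpan K V N :=
  Submodule.subset_span ⟨v, v', t, l, m, hl, hm, h, rfl⟩

lemma pathElem_mem_monomialSpan {v t : V} {l : List (Quiver.Total V)} (hl : Walk v l t) :
    pathElem K l t ∈ monomialSpan K V 0 := by
  rw [← pathElem_mul_vertexElem]
  exact mem_monomialSpan hl (show Walk t [] t from rfl) le_rfl

variable (K V) in
/-- The span of all monomials `α β*`. -/
noncomputable def monomialSpanTop : Submodule K (LeavittPathAlgebra K V) :=
  Submodule.span K {x | ∃ (v v' t : V) (l m : List (Quiver.Total V)), Walk v l t ∧ Walk v' m t ∧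
    x = pathElem K l t * ghostPathElem K m t}

lemma generator_mul_mem (x : Generator V) {s : LeavittPathAlgebra K V}
    (hs : s ∈ monomialSpanTop K V) :
    RingQuot.mkAlgHom K (Rel K V) (gen K V x) * s ∈ monomialSpanTop K V := by
  induction hs using Submodule.span_induction with
  | zero => simp
  | add a b _ _ ha hb => rw [mul_add]; exact add_mem ha hb
  | smul k a _ ha => rw [mul_smul_comm]; exact Submodule.smul_mem _ _ ha
  | mem s hs =>
    obtain ⟨v, v', t, l, m, hl, hm, rfl⟩ := hs
    cases x with
    | vertex w =>
      change vertexElem K V w * _ ∈ _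
      by_cases hw : w = v
      · rw [hw, ← mul_assoc, hl.vertexElem_mul_pathElem]
        exact Submodule.subset_span ⟨v, v', t, l, m, hl, hm, rfl⟩
      · rw [← mul_assoc, hl.vertexElem_mul_pathElem_of_ne hw, zero_mul]
        exact zero_mem _
    | edge e =>
      change edgeElem K e * _ ∈ _
      by_cases he : e.right = v
      · rw [← mul_assoc]
        exact Submodule.subset_span ⟨e.left, v', t, e :: l, m, ⟨rfl, he ▸ hl⟩, hm, rfl⟩
      · rw [← hl.vertexElem_mul_pathElem, ← mul_assoc, ← mul_assoc,
          edgeElem_mul_vertexElem_of_ne K he, zero_mul, zero_mul]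
        exact zero_mem _
    | ghost e =>
      change ghostElem K e * _ ∈ _
      cases l with
      | nil =>
        rw [pathElem, vertexElem_mul_ghostPathElem]
        by_cases he : e.left = t
        · have hw : Walk t [e] e.right := ⟨he, rfl⟩
          have h1 : ghostElem K e * ghostPathElem K m t =
              pathElem K [] e.right * ghostPathElem K (m ++ [e]) e.right := by
            rw [pathElem, vertexElem_mul_ghostPathElem, ghostPathElem_append m hm hw,
              ghostPathElem, ghostPathElem, vertexElem_mul_ghostElem_self]
          rw [h1]
          exact Submodule.subset_span ⟨_, v', _, [], m ++ [e], rfl, hm.append hw, rfl⟩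
        · rw [← vertexElem_mul_ghostPathElem, ← mul_assoc, ghostElem_mul_vertexElem_of_ne K he,
            zero_mul]
          exact zero_mem _
      | cons f l =>
        rw [pathElem, ← mul_assoc, ← mul_assoc]
        by_cases hef : e = f
        · subst hef
          rw [ghostElem_mul_edgeElem_self, hl.2.vertexElem_mul_pathElem]
          exact Submodule.subset_span ⟨_, v', t, l, m, hl.2, hm, rfl⟩
        · rw [ghostElem_mul_edgeElem_of_ne K hef, zero_mul, zero_mul]
          exact zero_mem _

lemma mem_monomialSpanTop (a : LeavittPathAlgebra K V) : a ∈ monomialSpanTop K V := by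
  have h1 : (1 : LeavittPathAlgebra K V) ∈ monomialSpanTop K V := by
    rw [← sum_vertexElem]
    refine Submodule.sum_mem _ fun v _ => Submodule.subset_span
      ⟨v, v, v, [], [], rfl, rfl, ?_⟩
    exact (vertexElem_mul_self K v).symm
  obtain ⟨y, rfl⟩ := RingQuot.mkAlgHom_surjective K (Rel K V) a
  have key : ∀ s ∈ monomialSpanTop K V,
      RingQuot.mkAlgHom K (Rel K V) y * s ∈ monomialSpanTop K V := by
    induction y using FreeAlgebra.induction with
    | grade0 k =>
      intro s hs
      rw [AlgHom.commutes, ← Algebra.smul_def]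
      exact Submodule.smul_mem _ _ hs
    | grade1 x => exact fun s hs => generator_mul_mem x hs
    | mul a b ha hb =>
      intro s hs
      rw [map_mul, mul_assoc]
      exact ha _ (hb _ hs)
    | add a b ha hb =>
      intro s hs
      rw [map_add, add_mul]
      exact add_mem (ha _ hs) (hb _ hs)
  simpa using key 1 h1

lemma exists_mem_monomialSpan (a : LeavittPathAlgebra K V) : ∃ N, a ∈ monomialSpan K V N := by
  have ha := mem_monomialSpanTop a
  induction ha using Submodule.span_induction with
  | zero => exact ⟨0, zero_mem _⟩
  | add a b _ _ ha hb =>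
    obtain ⟨M, hM⟩ := ha
    obtain ⟨N, hN⟩ := hb
    exact ⟨max M N, add_mem (monomialSpan_mono (le_max_left _ _) hM)
      (monomialSpan_mono (le_max_right _ _) hN)⟩
  | smul k a _ ha =>
    obtain ⟨N, hN⟩ := ha
    exact ⟨N, Submodule.smul_mem _ _ hN⟩
  | mem a ha =>
    obtain ⟨v, v', t, l, m, hl, hm, rfl⟩ := ha
    exact ⟨m.length, mem_monomialSpan hl hm le_rfl⟩

/-! ### Reduction of a nonzero element to a polynomial in closed paths -/

lemma exists_mul_vertexElem_ne_zero {a : LeavittPathAlgebra K V} (ha : a ≠ 0) :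
    ∃ v, a * vertexElem K V v ≠ 0 := by
  by_contra! h
  refine ha ?_
  rw [← mul_one a, ← sum_vertexElem, Finset.mul_sum]
  exact Finset.sum_eq_zero fun v _ => h v

lemma mul_edgeElem_mem_monomialSpan {N : ℕ} {a : LeavittPathAlgebra K V}
    (ha : a ∈ monomialSpan K V (N + 1)) (e : Quiver.Total V) :
    a * edgeElem K e ∈ monomialSpan K V N := by
  induction ha using Submodule.span_induction with
  | zero => simp
  | add a b _ _ ha hb => rw [add_mul]; exact add_mem ha hb
  | smul k a _ ha => rw [smul_mul_assoc]; exact Submodule.smul_mem _ _ ha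
  | mem a ha =>
    obtain ⟨v, v', t, l, m, hl, hm, hN, rfl⟩ := ha
    cases m with
    | nil =>
      rw [ghostPathElem, pathElem_mul_vertexElem]
      by_cases he : t = e.left
      · have hw : Walk t [e] e.right := ⟨he.symm, rfl⟩
        have h1 : pathElem K l t * edgeElem K e = pathElem K (l ++ [e]) e.right := by
          rw [pathElem_append l hl hw, pathElem, pathElem, edgeElem_mul_vertexElem_self]
        rw [h1]
        exact monomialSpan_mono (Nat.zero_le N) (pathElem_mem_monomialSpan (hl.append hw))
      · rw [← pathElem_mul_vertexElem, mul_assoc, vertexElem_mul_edgeElem_of_ne K he, mul_zero]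
        exact zero_mem _
    | cons f m =>
      rw [ghostPathElem, mul_assoc, mul_assoc]
      by_cases hfe : f = e
      · subst hfe
        rw [ghostElem_mul_edgeElem_self, hm.2.ghostPathElem_mul_vertexElem]
        exact mem_monomialSpan hl hm.2 (by simpa using hN)
      · rw [ghostElem_mul_edgeElem_of_ne K hfe, mul_zero, mul_zero]
        exact zero_mem _

lemma mul_vertexElem_mem_monomialSpan_zero {N : ℕ} {a : LeavittPathAlgebra K V}
    (ha : a ∈ monomialSpan K V N) {w : V} (hw : ¬ ∃ e : Quiver.Total V, e.left = w) :
    a * vertexElem K V w ∈ monomialSpan K V 0 := by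
  induction ha using Submodule.span_induction with
  | zero => simp
  | add a b _ _ ha hb => rw [add_mul]; exact add_mem ha hb
  | smul k a _ ha => rw [smul_mul_assoc]; exact Submodule.smul_mem _ _ ha
  | mem a ha =>
    obtain ⟨v, v', t, l, m, hl, hm, hN, rfl⟩ := ha
    rw [mul_assoc]
    cases m with
    | nil =>
      by_cases ht : t = w
      · rw [ghostPathElem, ht, vertexElem_mul_self, ← ht, pathElem_mul_vertexElem]
        exact pathElem_mem_monomialSpan hl
      · rw [ghostPathElem, vertexElem_mul_of_ne K ht, mul_zero]
        exact zero_mem _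
    | cons f m =>
      rw [hm.ghostPathElem_mul_vertexElem_of_ne (fun h => hw ⟨f, hm.1.trans h⟩), mul_zero]
      exact zero_mem _

/-- Each nonzero element has a nonzero right multiple that is a combination of paths: by the
relation (CK2), some product with an edge or a sink is not zero, and the products with edges
shorten the ghost paths. -/
lemma exists_mul_mem_monomialSpan_zero {N : ℕ} {a : LeavittPathAlgebra K V}
    (ha : a ∈ monomialSpan K V N) (h0 : a ≠ 0) :
    ∃ y, a * y ∈ monomialSpan K V 0 ∧ a * y ≠ 0 := by
  induction N generalizing a with
  | zero => exact ⟨1, by simpa using ha, by simpa using h0⟩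
  | succ N ih =>
    obtain ⟨w, hw⟩ := exists_mul_vertexElem_ne_zero h0
    by_cases hs : ∃ e : Quiver.Total V, e.left = w
    · obtain ⟨e, he⟩ : ∃ e, a * edgeElem K e ≠ 0 := by
        by_contra! h
        refine hw ?_
        rw [← sum_edgeElem_mul_ghostElem K hs, Finset.mul_sum]
        exact Finset.sum_eq_zero fun e _ => by rw [← mul_assoc, h e, zero_mul]
      obtain ⟨y, hy, hy0⟩ := ih (mul_edgeElem_mem_monomialSpan ha e) he
      exact ⟨edgeElem K e * y, by rwa [← mul_assoc], by rwa [← mul_assoc]⟩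
    · exact ⟨_, mul_vertexElem_mem_monomialSpan_zero ha hs, hw⟩

variable (K) in
/-- The span of the closed paths of positive length at the vertex `u`. -/
noncomputable def closedPathSpan (u : V) : Submodule K (LeavittPathAlgebra K V) :=
  Submodule.span K {x | ∃ l, Walk u l u ∧ l ≠ [] ∧ x = pathElem K l u}

lemma exists_finsupp_of_mem_monomialSpan_zero {b : LeavittPathAlgebra K V}
    (hb : b ∈ monomialSpan K V 0) (t : V) :
    ∃ f : List (Quiver.Total V) →₀ K, (∀ l ∈ f.support, ∃ v, Walk v l t) ∧
      b * vertexElem K V t = f.sum fun l k => k • pathElem K l t := by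
  have h : b * vertexElem K V t ∈
      Submodule.span K ((fun l => pathElem K l t) '' {l | ∃ v, Walk v l t}) := by
    induction hb using Submodule.span_induction with
    | zero => simp
    | add a b _ _ ha hb => rw [add_mul]; exact add_mem ha hb
    | smul k a _ ha => rw [smul_mul_assoc]; exact Submodule.smul_mem _ _ ha
    | mem a ha =>
      obtain ⟨v, v', t', l, m, hl, hm, hN, rfl⟩ := ha
      obtain rfl : m = [] := List.length_eq_zero_iff.1 (Nat.le_zero.1 hN)
      rw [ghostPathElem, pathElem_mul_vertexElem]
      by_cases ht : t' = t
      · subst ht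
        rw [pathElem_mul_vertexElem]
        exact Submodule.subset_span ⟨l, ⟨v, hl⟩, rfl⟩
      · rw [pathElem_mul_vertexElem_of_ne _ ht]
        exact zero_mem _
  rw [Finsupp.mem_span_image_iff_linearCombination] at h
  obtain ⟨f, hf, hsum⟩ := h
  refine ⟨f, fun l hl => ?_, ?_⟩
  · exact (Finsupp.mem_supported K f).1 hf hl
  · rw [← hsum, Finsupp.linearCombination_apply]

/-- Multiplying a combination of paths by the ghost of one of its shortest terms from the left
gives a nonzero constant term. -/
lemma exists_sub_mem_closedPathSpan {a : LeavittPathAlgebra K V} (ha : a ≠ 0) :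
    ∃ (t : V) (x y : LeavittPathAlgebra K V) (k : K), k ≠ 0 ∧
      x * a * y - k • vertexElem K V t ∈ closedPathSpan K t := by
  obtain ⟨N, hN⟩ := exists_mem_monomialSpan a
  obtain ⟨y, hy, hy0⟩ := exists_mul_mem_monomialSpan_zero hN ha
  obtain ⟨t, ht⟩ := exists_mul_vertexElem_ne_zero hy0
  obtain ⟨f, hf, hsum⟩ := exists_finsupp_of_mem_monomialSpan_zero hy t
  have hne : f.support.Nonempty := by
    rw [Finset.nonempty_iff_ne_empty]
    intro h
    rw [Finsupp.support_eq_empty] at h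
    exact ht (by rw [hsum, h, Finsupp.sum_zero_index])
  obtain ⟨l, hl, hmin⟩ := f.support.exists_min_image List.length hne
  obtain ⟨v, hw⟩ := hf l hl
  refine ⟨t, ghostPathElem K l t, y * vertexElem K V t, f l, Finsupp.mem_support_iff.1 hl, ?_⟩
  rw [mul_assoc, ← mul_assoc a, hsum, Finsupp.sum, ← Finset.add_sum_erase _ _ hl, mul_add,
    mul_smul_comm, hw.ghostPathElem_mul_pathElem_self, add_sub_cancel_left, Finset.mul_sum]
  refine Submodule.sum_mem _ fun m hm => ?_
  obtain ⟨hml, hm⟩ := Finset.mem_erase.1 hm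
  obtain ⟨v', hw'⟩ := hf m hm
  rw [mul_smul_comm]
  refine Submodule.smul_mem _ _ ?_
  rcases hw.ghostPathElem_mul_pathElem (K := K) hw' (hmin m hm) with h | ⟨n, rfl, hn, h⟩
  · rw [h]
    exact zero_mem _
  · rw [h]
    exact Submodule.subset_span ⟨n, hn, fun h0 => hml (by simp [h0]), rfl⟩

/-- Conjugation by a path moves constant terms and closed paths to the range of the path. -/
lemma Walk.conj_mem_closedPathSpan {t u : V} {d : List (Quiver.Total V)} (hd : Walk t d u)
    {k : K} {z : LeavittPathAlgebra K V}
    (hz : z - k • vertexElem K V t ∈ closedPathSpan K t) :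
    ghostPathElem K d u * z * pathElem K d u - k • vertexElem K V u ∈ closedPathSpan K u := by
  have key : ∀ x ∈ closedPathSpan K t,
      ghostPathElem K d u * x * pathElem K d u ∈ closedPathSpan K u := by
    intro x hx
    induction hx using Submodule.span_induction with
    | zero => simp
    | add a b _ _ ha hb => rw [mul_add, add_mul]; exact add_mem ha hb
    | smul k a _ ha =>
      rw [mul_smul_comm, smul_mul_assoc]
      exact Submodule.smul_mem _ _ ha
    | mem x hx =>
      obtain ⟨l, hl, hl0, rfl⟩ := hx
      rw [mul_assoc, ← pathElem_append l hl hd]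
      rcases hd.ghostPathElem_mul_pathElem (K := K) (hl.append hd) (by simp) with
        h | ⟨n, hn, hwn, h⟩
      · rw [h]
        exact zero_mem _
      · rw [h]
        refine Submodule.subset_span ⟨n, hwn, fun h0 => hl0 ?_, rfl⟩
        rw [h0, List.append_nil] at hn
        simpa using hn
  have h := key _ hz
  rwa [mul_sub, sub_mul, mul_smul_comm, smul_mul_assoc, hd.ghostPathElem_mul_vertexElem,
    hd.ghostPathElem_mul_pathElem_self] at h

lemma mul_vertexElem_of_sub_mem {u : V} {k : K} {z : LeavittPathAlgebra K V}
    (hz : z - k • vertexElem K V u ∈ closedPathSpan K u) :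
    vertexElem K V u * z = z ∧ z * vertexElem K V u = z := by
  have key : ∀ x ∈ closedPathSpan K u, vertexElem K V u * x = x ∧ x * vertexElem K V u = x := by
    intro x hx
    induction hx using Submodule.span_induction with
    | zero => simp
    | add a b _ _ ha hb => rw [mul_add, add_mul, ha.1, ha.2, hb.1, hb.2]; simp
    | smul k a _ ha => rw [mul_smul_comm, smul_mul_assoc, ha.1, ha.2]; simp
    | mem x hx =>
      obtain ⟨l, hl, hl0, rfl⟩ := hx
      exact ⟨hl.vertexElem_mul_pathElem, pathElem_mul_vertexElem l u⟩
  have h := key _ hz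
  simpa [mul_sub, sub_mul, vertexElem_mul_self] using h

/-- Each nonzero element can be reduced to a polynomial in closed paths at a terminal vertex
with a nonzero constant term. -/
lemma exists_terminal_sub_mem_closedPathSpan {a : LeavittPathAlgebra K V} (ha : a ≠ 0) :
    ∃ (u : V) (x y : LeavittPathAlgebra K V) (k : K), IsTerminal u ∧ k ≠ 0 ∧
      x * a * y - k • vertexElem K V u ∈ closedPathSpan K u := by
  obtain ⟨t, x, y, k, hk, h⟩ := exists_sub_mem_closedPathSpan ha
  obtain ⟨u, ⟨d, hd⟩, hu⟩ := exists_terminal t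
  refine ⟨u, ghostPathElem K d u * x, y * pathElem K d u, k, hu, hk, ?_⟩
  simpa only [mul_assoc] using hd.conj_mem_closedPathSpan h

end Relations

/-! ### A graded representation and the nonvanishing of polynomials in closed paths -/

section Representation

open scoped Classical

variable (K : Type*) [Field K] {V : Type*}

/-- For each vertex `v` that is not a sink, the pairs of an edge starting at `v` and a natural
number can be numbered bijectively. -/
lemma exists_numbering (V : Type*) [Quiver V] [Finite (Quiver.Total V)] :
    ∃ ι : Quiver.Total V → ℕ → ℕ,
      (∀ (e f : Quiver.Total V) (m n : ℕ), e.left = f.left → ι e m = ι f n → e = f ∧ m = n) ∧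
      ∀ (e : Quiver.Total V) (m : ℕ), ∃ f n, f.left = e.left ∧ ι f n = m := by
  have h : ∀ v : V, (∃ e : Quiver.Total V, e.left = v) →
      Nonempty ({e : Quiver.Total V // e.left = v} × ℕ ≃ ℕ) := by
    rintro v ⟨e, he⟩
    have : Nonempty {e : Quiver.Total V // e.left = v} := ⟨⟨e, he⟩⟩
    exact nonempty_equiv_of_countable
  let σ := fun (v : V) (hv : ∃ e : Quiver.Total V, e.left = v) => (h v hv).some
  have key : ∀ (v : V) (hv : ∃ e : Quiver.Total V, e.left = v) (e : Quiver.Total V) (n : ℕ)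
      (he : e.left = v), σ e.left ⟨e, rfl⟩ (⟨e, rfl⟩, n) = σ v hv (⟨e, he⟩, n) := by
    rintro v hv e n rfl
    rfl
  refine ⟨fun e n => σ e.left ⟨e, rfl⟩ (⟨e, rfl⟩, n), ?_, ?_⟩
  · intro e f m n hef h
    dsimp only at h
    rw [key f.left ⟨f, rfl⟩ e m hef] at h
    simpa using (σ f.left ⟨f, rfl⟩).injective h
  · intro e m
    obtain ⟨⟨⟨f, hf⟩, n⟩, h⟩ := (σ e.left ⟨e, rfl⟩).surjective m
    exact ⟨f, n, hf, h ▸ key e.left ⟨e, rfl⟩ f n hf⟩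

/-- The action of a vertex on the space with basis `V × ℕ × ℤ`. -/
noncomputable def vertexOp (v : V) : Module.End K (V × ℕ × ℤ →₀ K) :=
  Finsupp.linearCombination K fun x => if x.1 = v then Finsupp.single x 1 else 0

variable {K}

lemma vertexOp_self (v : V) (y : ℕ × ℤ) :
    vertexOp K v (Finsupp.single (v, y) 1) = Finsupp.single (v, y) 1 := by
  simp [vertexOp]

lemma vertexOp_of_ne {v w : V} (h : w ≠ v) (y : ℕ × ℤ) :
    vertexOp K v (Finsupp.single (w, y) 1) = 0 := by
  simp [vertexOp, h]

variable (K) [Quiver V]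

/-- The action of an edge on the space with basis `V × ℕ × ℤ`, for a numbering `ι`. The last
component of a basis vector is its degree, which edges raise by one. -/
noncomputable def edgeOp (ι : Quiver.Total V → ℕ → ℕ) (e : Quiver.Total V) :
    Module.End K (V × ℕ × ℤ →₀ K) :=
  Finsupp.linearCombination K fun x =>
    if x.1 = e.right then Finsupp.single (e.left, ι e x.2.1, x.2.2 + 1) 1 else 0

/-- The action of a ghost edge on the space with basis `V × ℕ × ℤ`: the partial inverse of the
action of the edge. -/
noncomputable def ghostOp (ι : Quiver.Total V → ℕ → ℕ) (e : Quiver.Total V) :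
    Module.End K (V × ℕ × ℤ →₀ K) :=
  Finsupp.linearCombination K fun x =>
    if h : x.1 = e.left ∧ ∃ n, ι e n = x.2.1 then
      Finsupp.single (e.right, h.2.choose, x.2.2 - 1) 1 else 0

variable {K} {ι : Quiver.Total V → ℕ → ℕ}

lemma edgeOp_self (e : Quiver.Total V) (n : ℕ) (d : ℤ) :
    edgeOp K ι e (Finsupp.single (e.right, n, d) 1) =
      Finsupp.single (e.left, ι e n, d + 1) 1 := by
  simp [edgeOp]

lemma edgeOp_of_ne {e : Quiver.Total V} {w : V} (h : w ≠ e.right) (y : ℕ × ℤ) :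
    edgeOp K ι e (Finsupp.single (w, y) 1) = 0 := by
  simp [edgeOp, h]

lemma ghostOp_self (hι : ∀ e f m n, e.left = f.left → ι e m = ι f n → e = f ∧ m = n)
    (e : Quiver.Total V) (n : ℕ) (d : ℤ) :
    ghostOp K ι e (Finsupp.single (e.left, ι e n, d) 1) =
      Finsupp.single (e.right, n, d - 1) 1 := by
  have h : e.left = e.left ∧ ∃ m, ι e m = ι e n := ⟨rfl, n, rfl⟩
  have hc : h.2.choose = n := (hι e e _ _ rfl h.2.choose_spec).2
  rw [ghostOp, Finsupp.linearCombination_single, one_smul, dif_pos h, hc]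

lemma ghostOp_of_not {e : Quiver.Total V} {w : V} {m : ℕ} (d : ℤ)
    (h : ¬ (w = e.left ∧ ∃ n, ι e n = m)) :
    ghostOp K ι e (Finsupp.single (w, m, d) 1) = 0 := by
  rw [ghostOp, Finsupp.linearCombination_single, one_smul, dif_neg h]

variable (K V) in
/-- A numbering `ι` identifies `{v} × ℕ` with the disjoint union of copies of `ℕ` for the edges that
start at `v`, which gives the relation (CK2). -/
lemma exists_graded_representation [Fintype V] [Fintype (Quiver.Total V)] :
    ∃ ρ : LeavittPathAlgebra K V →ₐ[K] Module.End K (V × ℕ × ℤ →₀ K),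
      (∀ v, ρ (vertexElem K V v) = vertexOp K v) ∧
      ∃ ι : Quiver.Total V → ℕ → ℕ, ∀ e, ρ (edgeElem K e) = edgeOp K ι e := by
  obtain ⟨ι, hι, hι'⟩ := exists_numbering V
  let g : Generator V → Module.End K (V × ℕ × ℤ →₀ K) := fun
    | .vertex v => vertexOp K v
    | .edge e => edgeOp K ι e
    | .ghost e => ghostOp K ι e
  have ext : ∀ {A B : Module.End K (V × ℕ × ℤ →₀ K)},
      (∀ w m d, A (Finsupp.single (w, m, d) 1) = B (Finsupp.single (w, m, d) 1)) → A = B := by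
    intro A B h
    exact Finsupp.lhom_ext' fun x => LinearMap.ext_ring (h x.1 x.2.1 x.2.2)
  have hrel : ∀ ⦃x y⦄, Rel K V x y → FreeAlgebra.lift K g x = FreeAlgebra.lift K g y := by
    intro x y hxy
    cases hxy with
    | one =>
      simp only [map_one, map_sum, gen, FreeAlgebra.lift_ι_apply, g]
      refine ext fun w m d => ?_
      rw [LinearMap.sum_apply, Finset.sum_eq_single w, vertexOp_self, Module.End.one_apply]
      · exact fun v _ hv => vertexOp_of_ne hv.symm _
      · simp
    | vertex_mul_self v =>
      simp only [map_mul, gen, FreeAlgebra.lift_ι_apply, g]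
      refine ext fun w m d => ?_
      rw [Module.End.mul_apply]
      by_cases hw : w = v
      · rw [hw, vertexOp_self, vertexOp_self]
      · rw [vertexOp_of_ne hw, map_zero]
    | vertex_mul_of_ne v w hvw =>
      simp only [map_mul, map_zero, gen, FreeAlgebra.lift_ι_apply, g]
      refine ext fun t m d => ?_
      rw [Module.End.mul_apply, LinearMap.zero_apply]
      by_cases ht : t = w
      · rw [ht, vertexOp_self, vertexOp_of_ne hvw.symm]
      · rw [vertexOp_of_ne ht, map_zero]
    | source_mul_edge e =>
      simp only [map_mul, gen, FreeAlgebra.lift_ι_apply, g]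
      refine ext fun w m d => ?_
      rw [Module.End.mul_apply]
      by_cases hw : w = e.right
      · rw [hw, edgeOp_self, vertexOp_self]
      · rw [edgeOp_of_ne hw, map_zero]
    | edge_mul_range e =>
      simp only [map_mul, gen, FreeAlgebra.lift_ι_apply, g]
      refine ext fun w m d => ?_
      rw [Module.End.mul_apply]
      by_cases hw : w = e.right
      · rw [hw, vertexOp_self]
      · rw [vertexOp_of_ne hw, edgeOp_of_ne hw, map_zero]
    | range_mul_ghost e =>
      simp only [map_mul, gen, FreeAlgebra.lift_ι_apply, g]
      refine ext fun w m d => ?_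
      rw [Module.End.mul_apply]
      by_cases hw : w = e.left ∧ ∃ n, ι e n = m
      · obtain ⟨rfl, n, rfl⟩ := hw
        rw [ghostOp_self hι, vertexOp_self]
      · rw [ghostOp_of_not d hw, map_zero]
    | ghost_mul_source e =>
      simp only [map_mul, gen, FreeAlgebra.lift_ι_apply, g]
      refine ext fun w m d => ?_
      rw [Module.End.mul_apply]
      by_cases hw : w = e.left
      · rw [hw, vertexOp_self]
      · rw [vertexOp_of_ne hw, ghostOp_of_not d (fun h => hw h.1), map_zero]
    | ghost_mul_edge_self e =>
      simp only [map_mul, gen, FreeAlgebra.lift_ι_apply, g]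
      refine ext fun w m d => ?_
      rw [Module.End.mul_apply]
      by_cases hw : w = e.right
      · rw [hw, edgeOp_self, ghostOp_self hι, vertexOp_self, add_sub_cancel_right]
      · rw [edgeOp_of_ne hw, vertexOp_of_ne hw, map_zero]
    | ghost_mul_edge_of_ne e f hef =>
      simp only [map_mul, map_zero, gen, FreeAlgebra.lift_ι_apply, g]
      refine ext fun w m d => ?_
      rw [Module.End.mul_apply, LinearMap.zero_apply]
      by_cases hw : w = f.right
      · rw [hw, edgeOp_self, ghostOp_of_not]
        rintro ⟨h1, n, h2⟩
        exact hef (hι e f _ _ h1.symm h2).1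
      · rw [edgeOp_of_ne hw, map_zero]
    | sum_edge_mul_ghost v hv =>
      simp only [map_mul, map_sum, gen, FreeAlgebra.lift_ι_apply, g]
      refine ext fun w m d => ?_
      rw [LinearMap.sum_apply]
      by_cases hw : w = v
      · subst hw
        obtain ⟨e, rfl⟩ := hv
        obtain ⟨f, n, hf, rfl⟩ := hι' e m
        rw [Finset.sum_eq_single f, Module.End.mul_apply, ← hf, ghostOp_self hι, edgeOp_self,
          vertexOp_self, sub_add_cancel]
        · intro e' he' hne
          rw [Module.End.mul_apply, ghostOp_of_not, map_zero]
          rintro ⟨h1, n', h2⟩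
          exact hne (hι e' f _ _ (h1.symm.trans hf.symm) h2).1
        · simp [hf]
      · rw [vertexOp_of_ne hw, Finset.sum_eq_zero]
        intro e he
        rw [Module.End.mul_apply, ghostOp_of_not, map_zero]
        rintro ⟨h1, -⟩
        exact hw (h1.trans (Finset.mem_filter.1 he).2)
  refine ⟨RingQuot.liftAlgHom K ⟨FreeAlgebra.lift K g, hrel⟩, fun v => ?_, ι, fun e => ?_⟩
  · rw [vertexElem, RingQuot.liftAlgHom_mkAlgHom_apply, gen, FreeAlgebra.lift_ι_apply]
  · rw [edgeElem, RingQuot.liftAlgHom_mkAlgHom_apply, gen, FreeAlgebra.lift_ι_apply]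

/-- In the graded representation, a basis vector and its images under closed paths of positive
length have different degrees. -/
lemma ne_zero_of_sub_mem_closedPathSpan [Fintype V] [Fintype (Quiver.Total V)] {u : V} {k : K}
    (hk : k ≠ 0) {z : LeavittPathAlgebra K V}
    (hz : z - k • vertexElem K V u ∈ closedPathSpan K u) : z ≠ 0 := by
  obtain ⟨ρ, hv, ι, he⟩ := exists_graded_representation K V
  have hpath : ∀ (l : List (Quiver.Total V)) (t w : V) (n : ℕ) (d : ℤ),
      ρ (pathElem K l t) (Finsupp.single (w, n, d) 1) = 0 ∨
      ∃ w' n', ρ (pathElem K l t) (Finsupp.single (w, n, d) 1) =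
        Finsupp.single (w', n', d + l.length) 1 := by
    intro l t w n d
    induction l with
    | nil =>
      rw [pathElem, hv]
      by_cases hw : w = t
      · exact .inr ⟨w, n, by rw [hw, vertexOp_self]; simp⟩
      · exact .inl (vertexOp_of_ne hw _)
    | cons e l ih =>
      rw [pathElem, map_mul, Module.End.mul_apply, he]
      rcases ih with h | ⟨w', n', h⟩
      · exact .inl (by rw [h, map_zero])
      · rw [h]
        by_cases hw : w' = e.right
        · refine .inr ⟨e.left, ι e n', ?_⟩
          rw [hw, edgeOp_self, List.length_cons, Nat.cast_succ, add_assoc]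
        · exact .inl (edgeOp_of_ne hw _)
  have key : ∀ x ∈ closedPathSpan K u,
      ρ x (Finsupp.single (u, 0, 0) 1) (u, 0, 0) = 0 := by
    intro x hx
    induction hx using Submodule.span_induction with
    | zero => simp
    | add a b _ _ ha hb =>
      rw [map_add, LinearMap.add_apply, Finsupp.add_apply, ha, hb, add_zero]
    | smul k a _ ha =>
      rw [map_smul, LinearMap.smul_apply, Finsupp.smul_apply, ha, smul_zero]
    | mem x hx =>
      obtain ⟨l, hl, hl0, rfl⟩ := hx
      rcases hpath l u u 0 0 with h | ⟨w', n', h⟩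
      · rw [h, Finsupp.zero_apply]
      · rw [h, Finsupp.single_eq_of_ne]
        intro h'
        have hlen : l.length = 0 := by simpa using (congrArg (fun x => x.2.2) h').symm
        exact hl0 (List.length_eq_zero_iff.1 hlen)
  rintro rfl
  have h := key _ hz
  rw [zero_sub, map_neg, map_smul, hv, LinearMap.neg_apply, LinearMap.smul_apply, vertexOp_self,
    Finsupp.neg_apply, Finsupp.smul_apply, Finsupp.single_eq_same, smul_eq_mul, mul_one,
    neg_eq_zero] at h
  exact hk h

lemma vertexElem_ne_zero [Fintype V] [Fintype (Quiver.Total V)] (u : V) :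
    vertexElem K V u ≠ 0 :=
  ne_zero_of_sub_mem_closedPathSpan one_ne_zero (k := (1 : K)) (u := u) (by simp)

end Representation

section Corners

open scoped Classical

variable {K : Type*} [Field K] {V : Type*} [Quiver V] [Fintype V] [Fintype (Quiver.Total V)]

/-! ### Terminal vertices without branchings -/

/-- Below a vertex that is not branching, the relation (CK2) makes the paths unitary. -/
lemma Walk.pathElem_mul_ghostPathElem_self {v t : V} (hv : ¬ IsBranching v)
    {l : List (Quiver.Total V)} (h : Walk v l t) :
    pathElem K l t * ghostPathElem K l t = vertexElem K V v := by
  induction l generalizing v with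
  | nil => obtain rfl := h; exact vertexElem_mul_self K v
  | cons e l ih =>
    obtain ⟨rfl, h⟩ := h
    have hs : ({e' | e'.left = e.left} : Finset (Quiver.Total V)) = {e} := by
      ext f
      simp only [Finset.mem_filter, Finset.mem_univ, true_and, Finset.mem_singleton]
      refine ⟨fun hf => ?_, fun hf => hf ▸ rfl⟩
      by_contra hne
      exact hv ⟨f, e, hne, hf, hf ▸ .refl _⟩
    rw [pathElem, ghostPathElem, mul_assoc, ← mul_assoc (pathElem K l t),
      ih (fun hb => hv (hb.of_reach (reach_edge e))) h, vertexElem_mul_ghostElem_self,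
      ← sum_edgeElem_mul_ghostElem K ⟨e, rfl⟩, hs, Finset.sum_singleton]

/-- The range of a monomial `α β*` in the corner is joined to `u` by a path `γ`, and
`α β* = (α γ) (β γ)*` because `γ` is unitary. -/
lemma corner_mem_span {u : V} (ht : IsTerminal u) (hb : ¬ IsBranching u)
    (a : LeavittPathAlgebra K V) :
    vertexElem K V u * a * vertexElem K V u ∈ Submodule.span K
      {x | ∃ p q, Walk u p u ∧ Walk u q u ∧ x = pathElem K p u * ghostPathElem K q u} := by
  have ha := mem_monomialSpanTop a
  induction ha using Submodule.span_induction with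
  | zero => simp
  | add a b _ _ ha hb => rw [mul_add, add_mul]; exact add_mem ha hb
  | smul k a _ ha =>
    rw [mul_smul_comm, smul_mul_assoc]
    exact Submodule.smul_mem _ _ ha
  | mem a ha =>
    obtain ⟨v, v', t, l, m, hl, hm, rfl⟩ := ha
    rw [← mul_assoc, mul_assoc]
    by_cases hv : u = v
    · by_cases hv' : v' = u
      · subst hv hv'
        rw [hl.vertexElem_mul_pathElem, hm.ghostPathElem_mul_vertexElem]
        obtain ⟨d, hd⟩ := ht t ⟨l, hl⟩
        refine Submodule.subset_span ⟨l ++ d, m ++ d, hl.append hd, hm.append hd, ?_⟩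
        rw [pathElem_append l hl hd, ghostPathElem_append m hm hd, mul_assoc,
          ← mul_assoc (pathElem K d _), hd.pathElem_mul_ghostPathElem_self
            (fun h => hb (h.of_reach ⟨l, hl⟩)), vertexElem_mul_ghostPathElem]
      · rw [hm.ghostPathElem_mul_vertexElem_of_ne hv', mul_zero]
        exact zero_mem _
    · rw [hl.vertexElem_mul_pathElem_of_ne hv, zero_mul]
      exact zero_mem _

/-- The corner at a terminal vertex without branchings, which is a sink or lies on a cycle without
exits, is commutative: closed paths are determined by their lengths, so they commute, and they are
unitary. -/
lemma commute_corner {u : V} (ht : IsTerminal u) (hb : ¬ IsBranching u)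
    (a b : LeavittPathAlgebra K V) :
    Commute (vertexElem K V u * a * vertexElem K V u)
      (vertexElem K V u * b * vertexElem K V u) := by
  have hpp : ∀ {p q : List (Quiver.Total V)}, Walk u p u → Walk u q u →
      Commute (pathElem K p u) (pathElem K q u) := by
    intro p q hp hq
    rw [Commute, SemiconjBy, ← pathElem_append p hp hq, ← pathElem_append q hq hp,
      (hp.append hq).eq_of_length_eq hb (hq.append hp) (by simp [add_comm])]
  have hgg : ∀ {p q : List (Quiver.Total V)}, Walk u p u → Walk u q u →
      Commute (ghostPathElem K p u) (ghostPathElem K q u) := by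
    intro p q hp hq
    rw [Commute, SemiconjBy, ← ghostPathElem_append p hp hq, ← ghostPathElem_append q hq hp,
      (hp.append hq).eq_of_length_eq hb (hq.append hp) (by simp [add_comm])]
  have hpg : ∀ {p q : List (Quiver.Total V)}, Walk u p u → Walk u q u →
      Commute (pathElem K p u) (ghostPathElem K q u) := by
    intro p q hp hq
    calc pathElem K p u * ghostPathElem K q u
        = ghostPathElem K q u * pathElem K q u * (pathElem K p u * ghostPathElem K q u) := by
          rw [hq.ghostPathElem_mul_pathElem_self, ← mul_assoc, hp.vertexElem_mul_pathElem]
      _ = ghostPathElem K q u * (pathElem K q u * pathElem K p u) * ghostPathElem K q u := by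
          simp only [mul_assoc]
      _ = ghostPathElem K q u * pathElem K p u * (pathElem K q u * ghostPathElem K q u) := by
          rw [(hpp hq hp).eq]
          simp only [mul_assoc]
      _ = ghostPathElem K q u * pathElem K p u := by
          rw [hq.pathElem_mul_ghostPathElem_self hb, mul_assoc, pathElem_mul_vertexElem]
  have ha := corner_mem_span ht hb a
  have hb' := corner_mem_span ht hb b
  generalize vertexElem K V u * a * vertexElem K V u = a at *
  generalize vertexElem K V u * b * vertexElem K V u = b at *
  induction ha using Submodule.span_induction with
  | zero => exact Commute.zero_left _
  | add x y _ _ hx hy => exact hx.add_left hy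
  | smul k x _ hx => exact hx.smul_left k
  | mem x hx =>
    obtain ⟨p, q, hp, hq, rfl⟩ := hx
    induction hb' using Submodule.span_induction with
    | zero => exact Commute.zero_right _
    | add x y _ _ hx hy => exact hx.add_right hy
    | smul k x _ hx => exact hx.smul_right k
    | mem x hx =>
      obtain ⟨r, s, hr, hs, rfl⟩ := hx
      exact ((hpp hp hr).mul_right (hpg hp hs)).mul_left
        ((hpg hr hq).symm.mul_right (hgg hq hs))

/-! ### Terminal branching vertices -/

/-- Two closed walks `p` and `q` at `t` with different first edges give infinitely many closed
walks `pⁿ q`, none of which is an initial segment of another one. Conjugation by such a walk kills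
a given closed path of positive length for all but at most one `n`. -/
lemma eventually_conj_eq_zero {t : V} {e f : Quiver.Total V} (hef : e ≠ f)
    {l m : List (Quiver.Total V)} (hl : Walk t (e :: l) t) (hm : Walk t (f :: m) t)
    {x : LeavittPathAlgebra K V} (hx : x ∈ closedPathSpan K t) :
    ∀ᶠ n in Filter.cofinite, ghostPathElem K (powWord (e :: l) (f :: m) n) t * x *
      pathElem K (powWord (e :: l) (f :: m) n) t = 0 := by
  induction hx using Submodule.span_induction with
  | zero => simp
  | add a b _ _ ha hb =>
    filter_upwards [ha, hb] with n hna hnb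
    rw [mul_add, add_mul, hna, hnb, add_zero]
  | smul k a _ ha =>
    filter_upwards [ha] with n hna
    rw [mul_smul_comm, smul_mul_assoc, hna, smul_zero]
  | mem x hx =>
    obtain ⟨c, hc, hc0, rfl⟩ := hx
    have hpre : ∀ n, ghostPathElem K (powWord (e :: l) (f :: m) n) t * pathElem K c t *
        pathElem K (powWord (e :: l) (f :: m) n) t ≠ 0 →
        powWord (e :: l) (f :: m) n <+: c ++ powWord (e :: l) (f :: m) n := by
      intro n hn
      have hd := hl.powWord hm n
      rw [mul_assoc, ← pathElem_append c hc hd] at hn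
      rcases hd.ghostPathElem_mul_pathElem (K := K) (hc.append hd) (by simp) with h | ⟨n', h, -⟩
      · exact absurd h hn
      · exact ⟨n', h.symm⟩
    refine Filter.eventually_cofinite.2 (Set.Subsingleton.finite fun i hi j hj => ?_)
    rcases prefix_or_prefix_of_prefix_append hc0 (hpre i hi) (hpre j hj) with h | h
    · exact powWord_prefix hef h
    · exact (powWord_prefix hef h).symm

/-- A polynomial in closed paths at a terminal branching vertex with a nonzero constant term can be
reduced to each vertex which is reachable from that vertex. -/
lemma exists_mul_mul_eq_vertexElem {u v : V} (ht : IsTerminal u) (hb : IsBranching u)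
    (huv : Reach u v) {k : K} (hk : k ≠ 0) {z : LeavittPathAlgebra K V}
    (hz : z - k • vertexElem K V u ∈ closedPathSpan K u) :
    ∃ x y, x * z * y = vertexElem K V v := by
  obtain ⟨t, e, f, l, m, ⟨d, hd⟩, hef, hl, hm⟩ := exists_two_loops ht hb
  obtain ⟨n, hn⟩ := (eventually_conj_eq_zero hef hl hm (hd.conj_mem_closedPathSpan hz)).exists
  obtain ⟨c, hc⟩ := (ht t ⟨d, hd⟩).trans huv
  have hw := hl.powWord hm n
  rw [mul_sub, sub_mul, mul_smul_comm, smul_mul_assoc, hw.ghostPathElem_mul_vertexElem,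
    hw.ghostPathElem_mul_pathElem_self, sub_eq_zero] at hn
  refine ⟨k⁻¹ • (ghostPathElem K c v * ghostPathElem K (powWord (e :: l) (f :: m) n) t *
    ghostPathElem K d t), pathElem K d t * pathElem K (powWord (e :: l) (f :: m) n) t *
    pathElem K c v, ?_⟩
  have h : ghostPathElem K c v * (ghostPathElem K (powWord (e :: l) (f :: m) n) t *
      (ghostPathElem K d t * z * pathElem K d t) *
      pathElem K (powWord (e :: l) (f :: m) n) t) * pathElem K c v = k • vertexElem K V v := by
    rw [hn, mul_smul_comm, smul_mul_assoc, hc.ghostPathElem_mul_vertexElem,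
      hc.ghostPathElem_mul_pathElem_self]
  rw [smul_mul_assoc, smul_mul_assoc, inv_smul_eq_iff₀ hk, ← h]
  simp only [mul_assoc]

/-- The corner at the base of two closed paths with different first edges contains a proper
isometry, so it is not commutative. -/
lemma exists_not_commute {t : V} {e f : Quiver.Total V} (hef : e ≠ f)
    {l m : List (Quiver.Total V)} (hl : Walk t (e :: l) t) (hm : Walk t (f :: m) t) :
    pathElem K (e :: l) t * ghostPathElem K (e :: l) t ≠
      ghostPathElem K (e :: l) t * pathElem K (e :: l) t := by
  rw [hl.ghostPathElem_mul_pathElem_self]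
  intro h
  have h0 : pathElem K (f :: m) t = 0 := by
    rw [← hm.vertexElem_mul_pathElem, ← h, mul_assoc,
      ghostPathElem_mul_pathElem_cons_of_ne hef, mul_zero]
  refine vertexElem_ne_zero (K := K) t ?_
  rw [← hm.ghostPathElem_mul_pathElem_self, h0, mul_zero]

/-! ### Vertex ideals -/

lemma exists_common_reach {u v : V} {a : LeavittPathAlgebra K V}
    (h : vertexElem K V u * a * vertexElem K V v ≠ 0) : ∃ t, Reach u t ∧ Reach v t := by
  contrapose! h
  have ha := mem_monomialSpanTop a
  induction ha using Submodule.span_induction with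
  | zero => simp
  | add a b _ _ ha hb => rw [mul_add, add_mul, ha, hb, add_zero]
  | smul k a _ ha => rw [mul_smul_comm, smul_mul_assoc, ha, smul_zero]
  | mem a ha =>
    obtain ⟨w, w', t, l, m, hl, hm, rfl⟩ := ha
    rw [← mul_assoc, mul_assoc]
    by_cases hw : u = w
    · by_cases hw' : w' = v
      · subst hw hw'
        exact absurd ⟨m, hm⟩ (h t ⟨l, hl⟩)
      · rw [hm.ghostPathElem_mul_vertexElem_of_ne hw', mul_zero]
    · rw [hl.vertexElem_mul_pathElem_of_ne hw, zero_mul]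

lemma mul_eq_zero_of_mem_span_singleton {R : Type*} [Ring R] {u v z : R}
    (h : ∀ x, u * x * v = 0) (hz : z ∈ TwoSidedIdeal.span {v}) : u * z = 0 := by
  have key : ∀ x, u * x * z = 0 := by
    induction hz using TwoSidedIdeal.span_induction with
    | mem z hz => rw [Set.mem_singleton_iff.1 hz]; exact h
    | zero => simp
    | add a b _ _ ha hb => intro x; rw [mul_add, ha, hb, add_zero]
    | neg a _ ha => intro x; rw [mul_neg, ha, neg_zero]
    | left_absorb a z _ hz => intro x; rw [← mul_assoc, mul_assoc _ x, hz]
    | right_absorb b z _ hz => intro x; rw [← mul_assoc, hz, zero_mul]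
  simpa using key 1

/-- If the ideal generated by the vertex `v` contains an element `z` with `u z ≠ 0`, then `u` and
`v` reach a common vertex. -/
lemma exists_common_reach_of_mem_span {u v : V} {z : LeavittPathAlgebra K V}
    (hz : z ∈ TwoSidedIdeal.span {vertexElem K V v}) (h : vertexElem K V u * z ≠ 0) :
    ∃ t, Reach u t ∧ Reach v t := by
  by_contra hno
  refine h (mul_eq_zero_of_mem_span_singleton (fun x => ?_) hz)
  by_contra hx
  exact hno (exists_common_reach hx)

end Corners

/-! ### The ring-theoretic characterization -/

section Characterization

/-- An element `a` of a ring is extreme if it is zero or generates a minimal two-sided ideal, and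
no nonzero element `b` of this ideal has the property that the multiplication
`(bpb, bqb) ↦ bpbqb` on `bRb` is commutative. -/
def IsExtremeElement {R : Type*} [Ring R] (a : R) : Prop :=
  ∀ b ∈ TwoSidedIdeal.span {a}, b ≠ 0 →
    a ∈ TwoSidedIdeal.span {b} ∧ ∃ p q, b * p * b * q * b ≠ b * q * b * p * b

lemma mem_span_image_ringEquiv {R S : Type*} [Ring R] [Ring S] (φ : R ≃+* S) {s : Set R} {x : R}
    (hx : x ∈ TwoSidedIdeal.span s) : φ x ∈ TwoSidedIdeal.span (φ '' s) := by
  have h : TwoSidedIdeal.span s ≤ (TwoSidedIdeal.span (φ '' s)).comap φ :=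
    TwoSidedIdeal.span_le.2 fun y hy =>
      (TwoSidedIdeal.mem_comap φ).2 (TwoSidedIdeal.subset_span ⟨y, hy, rfl⟩)
  exact (TwoSidedIdeal.mem_comap φ).1 (h hx)

lemma IsExtremeElement.map {R S : Type*} [Ring R] [Ring S] (φ : R ≃+* S) {a : R}
    (ha : IsExtremeElement a) : IsExtremeElement (φ a) := by
  intro b hb hb0
  have hb' : φ.symm b ∈ TwoSidedIdeal.span {a} := by
    simpa using mem_span_image_ringEquiv φ.symm hb
  obtain ⟨h1, p, q, h2⟩ := ha _ hb' (by simpa using hb0)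
  refine ⟨by simpa using mem_span_image_ringEquiv φ h1, φ p, φ q, fun h => h2 ?_⟩
  simpa using congrArg φ.symm h

variable {K : Type*} [Field K] {V : Type*} [Quiver V] [Fintype V] [Fintype (Quiver.Total V)]

lemma mul_mul_mem_span {R : Type*} [Ring R] (x b y : R) :
    x * b * y ∈ TwoSidedIdeal.span {b} :=
  TwoSidedIdeal.mul_mem_right _ _ _ (TwoSidedIdeal.mul_mem_left _ _ _
    (TwoSidedIdeal.subset_span rfl))

/-- By the reduction at terminal branching vertices, each nonzero element of the ideal generated by
`u` generates this ideal, and its multiples on both sides include a vertex with a noncommutative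
corner. -/
lemma isExtremeElement_vertexElem {u : V} (hu : u ∈ extremeCycleVertices V) :
    IsExtremeElement (vertexElem K V u) := by
  obtain ⟨ht, hb⟩ := mem_extremeCycleVertices_iff.1 hu
  intro b hbu hb0
  obtain ⟨u', x, y, k, ht', hk, hz⟩ := exists_terminal_sub_mem_closedPathSpan hb0
  -- the terminal vertex `u'` to which `b` is reduced lies in the same component as `u`
  obtain ⟨t, ht1, ht2⟩ : ∃ t, Reach u' t ∧ Reach u t := by
    refine exists_common_reach_of_mem_span (K := K) (z := x * b * y) ?_ ?_
    · exact TwoSidedIdeal.mul_mem_right _ _ _ (TwoSidedIdeal.mul_mem_left _ _ _ hbu)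
    · rw [(mul_vertexElem_of_sub_mem hz).1]
      exact ne_zero_of_sub_mem_closedPathSpan hk hz
  have hu' : Reach u' u := ht1.trans (ht t ht2)
  have hb' : IsBranching u' := hb.of_reach hu'
  have key : ∀ v, Reach u v → ∃ x y, x * b * y = vertexElem K V v := by
    intro v hv
    obtain ⟨x', y', h⟩ := exists_mul_mul_eq_vertexElem ht' hb' (hu'.trans hv) hk hz
    exact ⟨x' * x, y * y', by simpa only [mul_assoc] using h⟩
  constructor
  · obtain ⟨x, y, h⟩ := key u (.refl u)
    exact h ▸ mul_mul_mem_span x b y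
  · obtain ⟨v, e, f, l, m, hv, hef, hl, hm⟩ := exists_two_loops ht hb
    obtain ⟨x, y, h⟩ := key v hv
    refine ⟨y * pathElem K (e :: l) v * x, y * ghostPathElem K (e :: l) v * x, fun heq => ?_⟩
    refine exists_not_commute (K := K) hef hl hm ?_
    have h2 : (x * b * y) * pathElem K (e :: l) v * (x * b * y) *
          ghostPathElem K (e :: l) v * (x * b * y) =
        (x * b * y) * ghostPathElem K (e :: l) v * (x * b * y) *
          pathElem K (e :: l) v * (x * b * y) := by
      simpa only [mul_assoc] using congrArg (fun w => x * w * y) heq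
    rw [h] at h2
    rwa [hl.vertexElem_mul_pathElem, pathElem_mul_vertexElem, mul_assoc,
      hl.ghostPathElem_mul_vertexElem, vertexElem_mul_ghostPathElem,
      hl.ghostPathElem_mul_vertexElem, mul_assoc, pathElem_mul_vertexElem] at h2

lemma IsExtremeElement.mem_vertexIdeal {a : LeavittPathAlgebra K V} (ha : IsExtremeElement a) :
    a ∈ vertexIdeal K V (extremeCycleVertices V) := by
  by_cases ha0 : a = 0
  · rw [ha0]
    exact zero_mem _
  obtain ⟨u, x, y, k, ht, hk, hz⟩ := exists_terminal_sub_mem_closedPathSpan ha0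
  have hmem := mul_mul_mem_span x a y
  have hne := ne_zero_of_sub_mem_closedPathSpan hk hz
  have hcorner := mul_vertexElem_of_sub_mem hz
  generalize x * a * y = z at *
  by_cases hb : IsBranching u
  · obtain ⟨x', y', h⟩ := exists_mul_mul_eq_vertexElem ht hb (.refl u) hk hz
    have hu : vertexElem K V u ∈ TwoSidedIdeal.span {a} := by
      rw [← h]
      exact TwoSidedIdeal.mul_mem_right _ _ _ (TwoSidedIdeal.mul_mem_left _ _ _ hmem)
    have hle : TwoSidedIdeal.span {vertexElem K V u} ≤
        vertexIdeal K V (extremeCycleVertices V) :=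
      TwoSidedIdeal.span_mono (Set.singleton_subset_iff.2
        ⟨u, mem_extremeCycleVertices_iff.2 ⟨ht, hb⟩, rfl⟩)
    exact hle (ha _ hu (vertexElem_ne_zero u)).1
  · -- `z` lies in a commutative corner, which contradicts the second property of `a`
    obtain ⟨-, p, q, h⟩ := ha z hmem hne
    refine absurd ?_ h
    have hexp : ∀ p q, z * p * z * q * z =
        z * ((vertexElem K V u * p * vertexElem K V u) * z *
          (vertexElem K V u * q * vertexElem K V u)) * z := by
      intro p q
      calc z * p * z * q * z
          = (z * vertexElem K V u) * p * (vertexElem K V u * z * vertexElem K V u) * q *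
              (vertexElem K V u * z) := by rw [hcorner.1, hcorner.2]
        _ = _ := by simp only [mul_assoc]
    have hzc : vertexElem K V u * z * vertexElem K V u = z := by rw [hcorner.1, hcorner.2]
    have hzp := commute_corner ht hb z p
    have hzq := commute_corner ht hb z q
    rw [hzc] at hzp hzq
    rw [hexp p q, hexp q p, ← hzp.eq, ← hzq.eq, mul_assoc z, mul_assoc z,
      (commute_corner ht hb p q).eq]
    simp only [mul_assoc]

lemma vertexIdeal_extremeCycleVertices :
    vertexIdeal K V (extremeCycleVertices V) =
      TwoSidedIdeal.span {a : LeavittPathAlgebra K V | IsExtremeElement a} := by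
  refine le_antisymm (TwoSidedIdeal.span_mono ?_) (TwoSidedIdeal.span_le.2 fun a ha => ?_)
  · rintro _ ⟨u, hu, rfl⟩
    exact isExtremeElement_vertexElem hu
  · exact IsExtremeElement.mem_vertexIdeal ha

end Characterization

end LeavittPath

theorem mainTheorem3 {K : Type*} [Field K]
    {E : Type*} [Quiver E] [Fintype E] [Fintype (Quiver.Total E)]
    {F : Type*} [Quiver F] [Fintype F] [Fintype (Quiver.Total F)]
    (φ : LeavittPath.LeavittPathAlgebra K E ≃+* LeavittPath.LeavittPathAlgebra K F) :
    φ '' (LeavittPath.vertexIdeal K E (LeavittPath.extremeCycleVertices E) :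
        Set (LeavittPath.LeavittPathAlgebra K E)) =
      (LeavittPath.vertexIdeal K F (LeavittPath.extremeCycleVertices F) :
        Set (LeavittPath.LeavittPathAlgebra K F)) := by
  rw [LeavittPath.vertexIdeal_extremeCycleVertices, LeavittPath.vertexIdeal_extremeCycleVertices]
  refine Set.Subset.antisymm ?_ fun y hy => ⟨φ.symm y, ?_, φ.apply_symm_apply y⟩
  · rintro _ ⟨x, hx, rfl⟩
    refine TwoSidedIdeal.span_mono ?_ (LeavittPath.mem_span_image_ringEquiv φ hx)
    rintro _ ⟨a, ha, rfl⟩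
    exact ha.map φ
  · refine TwoSidedIdeal.span_mono ?_ (LeavittPath.mem_span_image_ringEquiv φ.symm hy)
    rintro _ ⟨a, ha, rfl⟩
    exact ha.map φ.symm
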